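/- Let $r\ge 1$, let $I\subseteq\mathbb R$ be an interval (bounded or unbounded, open or closed at either end), and let $w_1,\dots,w_r:I\to\mathbb R$ be continuous functions with $\int_I |x|^k|w_j(x)|\,dx<\infty$ for all $k\in\mathbb N$ and all $j$. For a multi-index $\vec n=(n_1,\dots,n_r)\in\mathbb N^r$ put $|\vec n|=n_1+\dots+n_r$. Assume that $(w_1,\dots,w_r)$ is an AT system on $I$ for every $\vec n\in\mathbb N^r$; that is, for every $\vec n$ the $|\vec n|$ functions $x^kw_j(x)$ $(1\le j\le r,\ 0\le k<n_j)$ are linearly independent on $I$, and every nontrivial real linear combination of them has at most $|\vec n|-1$ zeros on $I$. Then for each $\vec n$ there is exactly one monic polynomial $P_{\vec n}$ of degree $|\vec n|$ (the type II multiple orthogonal polynomial) with $\int_I P_{\vec n}(x)x^kw_j(x)\,dx=0$ for $1\le j\le r$ and $0\le k<n_j$. Moreover, with $N=|\vec n|$, $f_i(x)=x^{i-1}$ for $1\le i\le N$, and $g_1,\dots,g_N$ the functions $w_1,xw_1,\dots,x^{n_1-1}w_1,\dots,w_r,xw_r,\dots,x^{n_r-1}w_r$ in this order, the function $$\frac1{Z_N}\det\big(f_i(x_j)\big)_{i,j=1}^N\det\big(g_i(x_j)\big)_{i,j=1}^N$$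 is, for a suitable normalizing constant $Z_N\neq0$, a probability density on $I^N$ (the multiple orthogonal polynomial ensemble). Let $\mathbb E$ denote the expectation with respect to it, and for $m\in\mathbb N$ consider the $m$-th moment $$M_{\vec n,m}(z)=\mathbb E\Big[\prod_{k=1}^{N}(z-x_k)^m\Big],$$ which is finite for all $z\in\mathbb C$. The following hold. 1. Let $(\vec n_0,\dots,\vec n_{m-1})$ be any path starting from $\vec n$: $\vec n_0=\vec n$, $|\vec n_j|=|\vec n|+j$, and $\vec n_0\le\vec n_1\le\dots\le\vec n_{m-1}$ componentwise. Then for all $z\in\mathbb C$ $$M_{\vec n,m}(z)=\frac{1}{\prod_{i=0}^{m-1}i!}\,\det\Big(P^{(i)}_{\vec n_j}(z)\Big)_{i,j=0}^{m-1}.$$ 2. If $m$ is even, then $M_{\vec n,m}(x)>0$ for all $x\in\mathbb R$. 3. If $m$ is odd, then $M_{\vec n,m}$ has exactly $|\vec n|$ real zeros, all of them simple. Furthermore, for each $k\in\{1,\dots,r\}$, with $\vec e_k$ the $k$-th standard unit vector, the real zeros $a_1<\dots<a_N$ of $M_{\vec n,m}$ and the real zeros $b_1<\dots<b_{N+1}$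 of $M_{\vec n+\vec e_k,m}$ strictly interlace: $b_1<a_1<b_2<a_2<\dots<a_N<b_{N+1}$. -/

import Mathlib

open MeasureTheory Polynomial

noncomputable section

namespace MOP

variable {r : ℕ}

/-- The size `|n| = n₁ + ⋯ + n_r` of a multi-index. -/
def size (n : Fin r → ℕ) : ℕ := ∑ j, n j

/-- A finite family of real functions is a Chebyshev system on `I`: it is linearly independent on
`I`, and every nontrivial linear combination has at most `N - 1` zeros on `I`, where `N` is the
number of functions in the family. -/
structure IsChebyshevSystem {ι : Type} [Fintype ι] (I : Set ℝ) (φ : ι → ℝ → ℝ) : Prop where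
  linearIndependent : LinearIndependent ℝ (fun i (x : I) => φ i x)
  zeros_lt : ∀ c : ι → ℝ, c ≠ 0 →
    {x ∈ I | ∑ i, c i * φ i x = 0}.encard < (Fintype.card ι : ℕ∞)

/-- The functions `w₁, x w₁, …, x^(n₁-1) w₁, …, w_r, x w_r, …, x^(n_r-1) w_r`; the function with
index `⟨j, k⟩` is `x ↦ x ^ k * w_j x`. -/
def weightFamily (w : Fin r → ℝ → ℝ) (n : Fin r → ℕ) (p : Σ j : Fin r, Fin (n j)) (x : ℝ) : ℝ :=
  x ^ (p.2 : ℕ) * w p.1 x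

/-- The weights form an algebraic Chebyshev (AT) system on `I` for the multi-index `n`. -/
def IsATSystem (I : Set ℝ) (w : Fin r → ℝ → ℝ) (n : Fin r → ℕ) : Prop :=
  IsChebyshevSystem I (weightFamily w n)

/-- `P` is monic of degree `|n|` and satisfies the type II orthogonality conditions
`∫_I P(x) x^k w_j(x) dx = 0` for `k = 0, …, n_j - 1` and `j = 1, …, r`. -/
structure IsTypeII (I : Set ℝ) (w : Fin r → ℝ → ℝ) (n : Fin r → ℕ) (P : ℝ[X]) : Prop where
  monic : P.Monic
  natDegree_eq : P.natDegree = size n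
  orthogonal : ∀ j : Fin r, ∀ k < n j, ∫ x in I, P.eval x * x ^ k * w j x = 0

/-- The type II multiple orthogonal polynomial `P_n` (an arbitrary polynomial if there is none
with the defining properties). -/
def typeII (I : Set ℝ) (w : Fin r → ℝ → ℝ) (n : Fin r → ℕ) : ℝ[X] :=
  Classical.epsilon (IsTypeII I w n)

/-- `(p 0, …, p (l-1))` is a path of multi-indices starting from `n`: it is componentwise
nondecreasing and the size grows by one in each step. -/
structure IsPath (n : Fin r → ℕ) {l : ℕ} (p : Fin l → Fin r → ℕ) : Prop where
  start : ∀ h : 0 < l, p ⟨0, h⟩ = n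
  size_eq : ∀ i : Fin l, size (p i) = size n + i
  mono : Monotone p

/-- The Wronskian of the polynomials `f 0, …, f (l-1)`: the entry in row `i` and column `j` is the
`i`-th derivative of `f j`. -/
def wronskian {l : ℕ} (f : Fin l → ℝ[X]) : ℝ[X] :=
  (Matrix.of fun i j : Fin l => derivative^[(i : ℕ)] (f j)).det

/-- The function `g_i`, `i = 1, …, |n|` (here counted from `0`): the functions
`x^k w_j(x)`, `k < n_j`, listed block by block. -/
def gFun (w : Fin r → ℝ → ℝ) (n : Fin r → ℕ) (i : Fin (size n)) (x : ℝ) : ℝ :=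
  weightFamily w n (finSigmaFinEquiv.symm i) x

/-- The product `det (f_i(x_j)) * det (g_i(x_j))`, where `f_i(x) = x ^ i` for `0 ≤ i < |n|`. -/
def detProduct (w : Fin r → ℝ → ℝ) (n : Fin r → ℕ) (x : Fin (size n) → ℝ) : ℝ :=
  (Matrix.of fun i j : Fin (size n) => x j ^ (i : ℕ)).det *
    (Matrix.of fun i j : Fin (size n) => gFun w n i (x j)).det

/-- The cube `I^N` in `ℝ^N`. -/
def cube (I : Set ℝ) (N : ℕ) : Set (Fin N → ℝ) := Set.univ.pi fun _ => I

/-- The normalizing constant `Z_n`. -/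
def normConst (I : Set ℝ) (w : Fin r → ℝ → ℝ) (n : Fin r → ℕ) : ℝ :=
  ∫ x in cube I (size n), detProduct w n x

/-- The joint density of the multiple orthogonal polynomial ensemble on `I^|n|`. -/
def jointDensity (I : Set ℝ) (w : Fin r → ℝ → ℝ) (n : Fin r → ℕ) (x : Fin (size n) → ℝ) : ℝ :=
  (normConst I w n)⁻¹ * detProduct w n x

/-- The law of the `|n|` random points: the measure on `ℝ^|n|` with the joint density above,
which vanishes outside `I^|n|`. -/
def ensemble (I : Set ℝ) (w : Fin r → ℝ → ℝ) (n : Fin r → ℕ) : Measure (Fin (size n) → ℝ) :=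
  (volume.restrict (cube I (size n))).withDensity fun x => ENNReal.ofReal (jointDensity I w n x)

/-- The random variable `∏ k, (z - x_k) ^ m`, for real or complex `z`. -/
def charPow {𝕜 : Type} [RCLike 𝕜] (N m : ℕ) (z : 𝕜) (x : Fin N → ℝ) : 𝕜 :=
  ∏ k, (z - (x k : 𝕜)) ^ m

/-- The `m`-th moment `𝔼[∏ k, (z - x_k) ^ m]` of the average characteristic polynomial. -/
def moment {𝕜 : Type} [RCLike 𝕜] (I : Set ℝ) (w : Fin r → ℝ → ℝ) (n : Fin r → ℕ) (m : ℕ)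
    (z : 𝕜) : 𝕜 :=
  ∫ x, charPow (size n) m z x ∂(ensemble I w n)

/-- The real zeros of the `m`-th moment. -/
def momentZeros (I : Set ℝ) (w : Fin r → ℝ → ℝ) (n : Fin r → ℕ) (m : ℕ) : Set ℝ :=
  {x : ℝ | moment I w n m x = 0}

/-- `A` consists of `N` points `a 0, …, a (N-1)` and `B` of `N + 1` points `b 0, …, b N`, with
`b 0 < a 0 < b 1 < a 1 < ⋯ < a (N-1) < b N`. -/
def StrictlyInterlace (N : ℕ) (A B : Set ℝ) : Prop :=
  ∃ (a : Fin N → ℝ) (b : Fin (N + 1) → ℝ), Set.range a = A ∧ Set.range b = B ∧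
    ∀ i : Fin N, b i.castSucc < a i ∧ a i < b i.succ

end MOP

end

/-! Multiplying the Vandermonde determinant of the points `x k` by `∏ (z - x k) ^ m` produces a
confluent Vandermonde determinant in which `z` is a node of multiplicity `m`, and its monomial rows
may be replaced by any monic polynomials of the same degrees (`det_confluent`). Take type II
polynomials along a path as the last `m` rows. A bordered Andréief identity (`integral_det_mul_det`)
turns the integral over the cube into one determinant, which orthogonality makes block triangular: a
Gram determinant, absorbed by the normalization, times a determinant of Taylor coefficients, which
is the Wronskian up to factorials (`IsATWeights.moment_eq_wronskian`).

The AT property prevents `det (g_i(x_j))` from vanishing at distinct points, so it has one sign on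
the ordered part of the cube. Hence the density is positive off the diagonals, and even moments are
positive on the real line.

For odd `m`, write `M(n, m)` for the moment. Sylvester's identity applied to Wronskians shows that
`M(n, m) M(n + e_k, m)' - M(n, m)' M(n + e_k, m)` is a positive multiple of `M(n, m + 1) M(n + e_k,
m - 1)`, a product of two even moments, hence positive (`IsATWeights.moment_wronskian_pos`). So real
zeros are simple. With the signs at `±∞`, read off from `M(n, m) ~ x ^ (|n| m)`, this positivity
gives interlacing (`exists_interlacing_zeros`), and induction on `|n|` counts the zeros. -/

namespace MOP

/-! ### Confluent Vandermonde determinants -/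

section LinearAlgebra

variable {R : Type*} [CommRing R]

/-- The determinant of the values of linear functionals on a sequence of monic polynomials of
degrees `0, 1, …` does not depend on the sequence. -/
theorem det_functional_monic {n : ℕ} (L : Fin n → R[X] →ₗ[R] R) (q : Fin n → R[X])
    (hdeg : ∀ i, (q i).natDegree = i) (hq : ∀ i, (q i).Monic) :
    (Matrix.of fun i c => L c (q i)).det =
      (Matrix.of fun i c : Fin n => L c (X ^ (i : ℕ))).det := by
  have h : (Matrix.of fun i c => L c (q i)) =
      (Matrix.of fun i j : Fin n => (q j).coeff i).transpose *
        Matrix.of fun i c : Fin n => L c (X ^ (i : ℕ)) := by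
    ext i c
    have hi : q i = ∑ k : Fin n, (q i).coeff k • X ^ (k : ℕ) := by
      conv_lhs => rw [(q i).as_sum_range' n (by rw [hdeg]; exact i.2), Finset.sum_range]
      simp [smul_eq_C_mul, C_mul_X_pow_eq_monomial]
    simp only [Matrix.of_apply, Matrix.mul_apply, Matrix.transpose_apply]
    conv_lhs => rw [hi]
    simp
  rw [h, Matrix.det_mul, Matrix.det_transpose,
    Matrix.det_matrixOfPolynomials q hdeg hq, one_mul]

theorem det_functional_monic_sum {N m : ℕ} (L : Fin N ⊕ Fin m → R[X] →ₗ[R] R)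
    (q q' : Fin N ⊕ Fin m → R[X])
    (hdeg : ∀ i, (q i).natDegree = finSumFinEquiv i) (hq : ∀ i, (q i).Monic)
    (hdeg' : ∀ i, (q' i).natDegree = finSumFinEquiv i) (hq' : ∀ i, (q' i).Monic) :
    (Matrix.of fun i c => L c (q i)).det = (Matrix.of fun i c => L c (q' i)).det := by
  have key : ∀ q : Fin N ⊕ Fin m → R[X], (∀ i, (q i).natDegree = finSumFinEquiv i) →
      (∀ i, (q i).Monic) → (Matrix.of fun i c => L c (q i)).det =
        (Matrix.of fun i c : Fin (N + m) => L (finSumFinEquiv.symm c) (X ^ (i : ℕ))).det := by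
    intro q hdeg hq
    rw [← det_functional_monic (fun c => L (finSumFinEquiv.symm c))
      (fun i => q (finSumFinEquiv.symm i)) (by simp [hdeg]) (fun i => hq _),
      ← Matrix.det_submatrix_equiv_self finSumFinEquiv]
    congr 1
    ext i j
    simp
  rw [key q hdeg hq, key q' hdeg' hq']

/-- The linear functionals of the confluent Vandermonde matrix: evaluation at the nodes `x j` and
the Taylor coefficients at `z`. -/
noncomputable def confluentFunctional {N m : ℕ} (x : Fin N → R) (z : R) :
    Fin N ⊕ Fin m → R[X] →ₗ[R] R :=
  Sum.elim (fun j => Polynomial.leval (x j)) fun l => lcoeff R l ∘ₗ taylor z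

/-- The rows may be traded for `X ^ i` and `p * (X - C z) ^ j`, where `p` vanishes at every node.
The latter rows are zero in the node columns, and their Taylor coefficients at `z` form a triangular
matrix with diagonal entries `p(z)`. -/
theorem det_confluent {N m : ℕ} (x : Fin N → R) (z : R) (q : Fin N ⊕ Fin m → R[X])
    (hdeg : ∀ i, (q i).natDegree = finSumFinEquiv i) (hq : ∀ i, (q i).Monic) :
    (Matrix.of fun i c => confluentFunctional x z c (q i)).det =
      (Matrix.of fun i j : Fin N => x j ^ (i : ℕ)).det * ∏ k, (z - x k) ^ m := by
  nontriviality R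
  set p : R[X] := ∏ k, (X - C (x k)) with hp
  have hpm : p.Monic := monic_prod_of_monic _ _ fun k _ => monic_X_sub_C _
  have hpd : p.natDegree = N := by
    rw [hp, natDegree_prod_of_monic _ _ fun k _ => monic_X_sub_C _]; simp
  set q' : Fin N ⊕ Fin m → R[X] :=
    Sum.elim (fun i => X ^ (i : ℕ)) (fun j => p * (X - C z) ^ (j : ℕ)) with hq'
  have hm : ∀ j : ℕ, ((X - C z) ^ j).Monic := fun j => (monic_X_sub_C z).pow j
  rw [det_functional_monic_sum _ q q' hdeg hq]
  · have hblock : (Matrix.of fun i c => confluentFunctional x z c (q' i)) =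
        Matrix.fromBlocks (Matrix.of fun i j : Fin N => x j ^ (i : ℕ))
          (Matrix.of fun (i : Fin N) (l : Fin m) => (taylor z (X ^ (i : ℕ))).coeff l) 0
          (Matrix.of fun j l : Fin m => (taylor z p * X ^ (j : ℕ)).coeff l) := by
      ext (i | i) (j | j)
      · simp [confluentFunctional, hq']
      · simp [confluentFunctional, hq']
      · simp only [hq', hp, confluentFunctional, Matrix.of_apply, Sum.elim_inr, Sum.elim_inl,
          Matrix.fromBlocks_apply₂₁, leval_apply, eval_mul, eval_prod, Matrix.zero_apply]
        rw [Finset.prod_eq_zero (Finset.mem_univ j) (by simp), zero_mul]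
      · simp [confluentFunctional, hq', taylor_mul, taylor_pow, taylor_X, taylor_C]
    have htri : (Matrix.of fun j l : Fin m => (taylor z p * X ^ (j : ℕ)).coeff l).det =
        ∏ k, (z - x k) ^ m := by
      rw [Matrix.det_of_isUpperTriangular]
      · have : ∀ i : Fin m, (Matrix.of fun j l : Fin m => (taylor z p * X ^ (j : ℕ)).coeff l) i i =
            ∏ k, (z - x k) := by
          intro i
          rw [Matrix.of_apply, coeff_mul_X_pow', if_pos le_rfl, Nat.sub_self, taylor_coeff_zero]
          simp [hp, eval_prod]
        simp [this, Finset.prod_pow]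
      · intro i j hij
        rw [Matrix.of_apply, coeff_mul_X_pow', if_neg]
        simpa using hij
    rw [hblock, Matrix.det_fromBlocks_zero₂₁, htri]
  · rintro (i | j)
    · simp [hq']
    · simp [hq', hpm.natDegree_mul (hm j), hpd, (monic_X_sub_C z).natDegree_pow]
  · rintro (i | j)
    · simp [hq']
    · exact hpm.mul (hm j)

end LinearAlgebra

/-! ### Andréief's identity with a constant border -/

section Andreief

variable {𝕜 : Type*} [RCLike 𝕜] {ι κ : Type*} [Fintype ι] [Fintype κ] [DecidableEq ι]
  [DecidableEq κ] (μ : Measure ℝ) [SigmaFinite μ]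

/-- In this form of the Leibniz expansion each summand is a product of factors in separate columns,
so that integration over a product measure can be done factor by factor. -/
theorem det_sum_columns (H : ι ⊕ κ → ι → 𝕜) (A : ι ⊕ κ → κ → 𝕜) :
    (Matrix.of fun i c => Sum.elim (H i) (A i) c).det =
      ∑ σ : Equiv.Perm (ι ⊕ κ), ((Equiv.Perm.sign σ : ℤ) : 𝕜) *
        (∏ l, A (σ (.inr l)) l) * ∏ j, H (σ (.inl j)) j := by
  rw [Matrix.det_apply']
  refine Finset.sum_congr rfl fun σ _ => ?_
  rw [Fintype.prod_sum_type]
  simp only [Matrix.of_apply, Sum.elim_inl, Sum.elim_inr]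
  ring

theorem integrable_det_columns (H : ι ⊕ κ → ι → ℝ → 𝕜) (A : ι ⊕ κ → κ → 𝕜)
    (hH : ∀ i j, Integrable (H i j) μ) :
    Integrable (fun x : ι → ℝ =>
      (Matrix.of fun i c => Sum.elim (fun j => H i j (x j)) (A i) c).det)
      (Measure.pi fun _ => μ) := by
  simp only [det_sum_columns]
  refine integrable_finsetSum _ fun σ _ => Integrable.const_mul ?_ _
  exact Integrable.fintype_prod (f := fun j => H (σ (.inl j)) j) fun j => hH _ _

theorem integral_det_columns (H : ι ⊕ κ → ι → ℝ → 𝕜) (A : ι ⊕ κ → κ → 𝕜)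
    (hH : ∀ i j, Integrable (H i j) μ) :
    ∫ x : ι → ℝ, (Matrix.of fun i c => Sum.elim (fun j => H i j (x j)) (A i) c).det
      ∂(Measure.pi fun _ => μ) =
    (Matrix.of fun i c => Sum.elim (fun j => ∫ t, H i j t ∂μ) (A i) c).det := by
  simp only [det_sum_columns]
  rw [integral_finsetSum]
  · refine Finset.sum_congr rfl fun σ _ => ?_
    rw [integral_const_mul,
      integral_fintype_prod_eq_prod (𝕜 := 𝕜) (fun j => H (σ (.inl j)) j) (μ := fun _ => μ)]
  · exact fun σ _ => Integrable.const_mul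
      (Integrable.fintype_prod (f := fun j => H (σ (.inl j)) j) fun j => hH _ _) _

theorem det_mul_det_eq_sum (F : ι ⊕ κ → ι → 𝕜) (A : ι ⊕ κ → κ → 𝕜) (g : ι → ι → 𝕜) :
    (Matrix.of fun i c => Sum.elim (F i) (A i) c).det * (Matrix.of g).det =
      ∑ σ : Equiv.Perm ι, ((Equiv.Perm.sign σ : ℤ) : 𝕜) *
        (Matrix.of fun i c => Sum.elim (fun j => F i j * g (σ j) j) (A i) c).det := by
  rw [Matrix.det_apply' (Matrix.of g), Finset.mul_sum]
  refine Finset.sum_congr rfl fun σ _ => ?_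
  rw [det_sum_columns, det_sum_columns, Finset.sum_mul, Finset.mul_sum]
  refine Finset.sum_congr rfl fun τ _ => ?_
  rw [Finset.prod_mul_distrib]
  simp only [Matrix.of_apply]
  ring

variable (F : ι ⊕ κ → ℝ → 𝕜) (A : ι ⊕ κ → κ → 𝕜) (g : ι → ℝ → 𝕜)

theorem integrable_det_mul_det (hF : ∀ i k, Integrable (fun t => F i t * g k t) μ) :
    Integrable (fun x : ι → ℝ =>
      (Matrix.of fun i c => Sum.elim (fun j => F i (x j)) (A i) c).det *
        (Matrix.of fun i j => g i (x j)).det) (Measure.pi fun _ => μ) := by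
  simp only [det_mul_det_eq_sum]
  exact integrable_finsetSum _ fun σ _ => Integrable.const_mul
    (integrable_det_columns μ (fun i j t => F i t * g (σ j) t) A fun i j => hF _ _) _

/-- A bordered version of Andréief's identity. -/
theorem integral_det_mul_det (hF : ∀ i k, Integrable (fun t => F i t * g k t) μ) :
    ∫ x : ι → ℝ, (Matrix.of fun i c => Sum.elim (fun j => F i (x j)) (A i) c).det *
        (Matrix.of fun i j => g i (x j)).det ∂(Measure.pi fun _ => μ) =
      (Fintype.card ι).factorial *
        (Matrix.of fun i c => Sum.elim (fun j => ∫ t, F i t * g j t ∂μ) (A i) c).det := by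
  simp only [det_mul_det_eq_sum]
  rw [integral_finsetSum]
  · have key : ∀ σ : Equiv.Perm ι, ∫ x : ι → ℝ, ((Equiv.Perm.sign σ : ℤ) : 𝕜) *
        (Matrix.of fun i c => Sum.elim (fun j => F i (x j) * g (σ j) (x j)) (A i) c).det
          ∂(Measure.pi fun _ => μ) =
        (Matrix.of fun i c => Sum.elim (fun j => ∫ t, F i t * g j t ∂μ) (A i) c).det := by
      intro σ
      rw [integral_const_mul,
        integral_det_columns μ (fun i j t => F i t * g (σ j) t) A fun i j => hF _ _]
      -- Undoing `σ` on the integrated columns costs its sign, which cancels the sign already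
      -- present; all `σ` therefore contribute equally.
      have hp := Matrix.det_permute' (σ.sumCongr (1 : Equiv.Perm κ))
        (Matrix.of fun i c => Sum.elim (fun j => ∫ t, F i t * g j t ∂μ) (A i) c)
      have he : (Matrix.of fun i c => Sum.elim (fun j => ∫ t, F i t * g j t ∂μ) (A i) c).submatrix
          id (σ.sumCongr (1 : Equiv.Perm κ)) =
          Matrix.of fun i c => Sum.elim (fun j => ∫ t, F i t * g (σ j) t ∂μ) (A i) c := by
        ext i (j | j) <;> simp
      rw [← he, hp, ← mul_assoc, Equiv.Perm.sign_sumCongr]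
      rcases Int.units_eq_one_or (Equiv.Perm.sign σ) with h | h <;> simp [h]
    simp only [key, Finset.sum_const, Finset.card_univ, Fintype.card_perm, nsmul_eq_mul]
  · exact fun σ _ => Integrable.const_mul
      (integrable_det_columns μ (fun i j t => F i t * g (σ j) t) A fun i j => hF _ _) _

end Andreief

end MOP

namespace MOP

/-! ### Interlacing from a positive Wronskian -/

section Interlacing

open Filter Topology

variable {N : ℕ}

/-- The `i`-th of the `N + 1` open intervals into which the points `a j` divide the line. -/
def gap (a : Fin N → ℝ) (i : Fin (N + 1)) : Set ℝ :=
  {x | ∀ j : Fin N, (j.castSucc < i → a j < x) ∧ (i ≤ j.castSucc → x < a j)}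

theorem ordConnected_gap (a : Fin N → ℝ) (i : Fin (N + 1)) : (gap a i).OrdConnected :=
  ⟨fun _ hx _ hy _ hz j =>
    ⟨fun h => ((hx j).1 h).trans_le hz.1, fun h => hz.2.trans_lt ((hy j).2 h)⟩⟩

theorem notMem_range_of_mem_gap {a : Fin N → ℝ} {i : Fin (N + 1)} {x : ℝ} (hx : x ∈ gap a i) :
    x ∉ Set.range a := by
  rintro ⟨j, rfl⟩
  rcases lt_or_ge j.castSucc i with h | h
  · exact lt_irrefl _ ((hx j).1 h)
  · exact lt_irrefl _ ((hx j).2 h)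

theorem exists_mem_gap {a : Fin N → ℝ} (ha : StrictMono a) {x : ℝ} (hx : x ∉ Set.range a) :
    ∃ i, x ∈ gap a i := by
  by_cases h : ∃ j, x < a j
  · obtain ⟨j, hj, hmin⟩ := WellFounded.has_min (wellFounded_lt (α := Fin N)) {j | x < a j} h
    refine ⟨j.castSucc, fun k => ⟨fun hk => ?_, fun hk => ?_⟩⟩
    · refine lt_of_le_of_ne (not_lt.1 fun h' => hmin k h' ?_) fun h' => hx ⟨k, h'⟩
      simpa using hk
    · exact lt_of_lt_of_le hj (ha.monotone (by simpa using hk))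
  · push Not at h
    refine ⟨Fin.last N, fun k => ⟨fun _ => lt_of_le_of_ne (h k) fun h' => hx ⟨k, h'⟩,
      fun hk => absurd hk (not_le.2 (Fin.castSucc_lt_last k))⟩⟩

theorem eventually_pos_nhdsLT {f : ℝ → ℝ} {f' a : ℝ} (hf : HasDerivAt f f' a) (h0 : f a = 0)
    (hf' : f' < 0) : ∀ᶠ x in 𝓝[<] a, 0 < f x := by
  have h := (hasDerivAt_iff_tendsto_slope.1 hf).eventually (eventually_lt_nhds hf')
  have h' := h.filter_mono (nhdsWithin_mono a fun x (hx : x < a) => hx.ne)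
  filter_upwards [h', self_mem_nhdsWithin] with x hx hxa
  rw [slope_def_field, h0, sub_zero, div_lt_iff_of_neg (sub_neg.2 hxa), zero_mul] at hx
  exact hx

theorem eventually_neg_nhdsGT {f : ℝ → ℝ} {f' a : ℝ} (hf : HasDerivAt f f' a) (h0 : f a = 0)
    (hf' : f' < 0) : ∀ᶠ x in 𝓝[>] a, f x < 0 := by
  have h := (hasDerivAt_iff_tendsto_slope.1 hf).eventually (eventually_lt_nhds hf')
  have h' := h.filter_mono (nhdsWithin_mono a fun x (hx : a < x) => hx.ne')
  filter_upwards [h', self_mem_nhdsWithin] with x hx hxa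
  rw [slope_def_field, h0, sub_zero, div_lt_iff₀ (sub_pos.2 hxa), zero_mul] at hx
  exact hx

/-- If the Wronskian of `A` and `B` is positive, and `A * B` is eventually positive at `+∞` and
eventually negative at `-∞`, then the zeros of `B` strictly interlace with those of `A`. -/
theorem exists_interlacing_zeros {A B A' B' : ℝ → ℝ} (hA : ∀ x, HasDerivAt A (A' x) x)
    (hB : ∀ x, HasDerivAt B (B' x) x) (hW : ∀ x, 0 < A x * B' x - A' x * B x)
    (htop : ∀ᶠ x in atTop, 0 < A x * B x) (hbot : ∀ᶠ x in atBot, A x * B x < 0)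
    {a : Fin N → ℝ} (ha : StrictMono a) (hrange : Set.range a = {x | A x = 0}) :
    ∃ b : Fin (N + 1) → ℝ, StrictMono b ∧ Set.range b = {x | B x = 0} ∧
      ∀ i : Fin N, b i.castSucc < a i ∧ a i < b i.succ := by
  have ha0 : ∀ j, A (a j) = 0 := fun j => by
    have : a j ∈ {x | A x = 0} := hrange ▸ Set.mem_range_self j
    exact this
  have hne : ∀ i, ∀ x ∈ gap a i, A x ≠ 0 := fun i x hx h0 =>
    notMem_range_of_mem_gap hx (hrange ▸ h0)
  have hAB : ∀ x, HasDerivAt (fun y => A y * B y) (A' x * B x + A x * B' x) x :=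
    fun x => (hA x).mul (hB x)
  -- At a zero of `A` the derivative of `A * B` is minus the Wronskian expression, so `A * B`
  -- crosses from positive to negative there.
  have hneg : ∀ j, A' (a j) * B (a j) + A (a j) * B' (a j) < 0 := fun j => by
    have := hW (a j)
    rw [ha0 j] at this ⊢
    linarith
  have hright : ∀ i, ∃ x ∈ gap a i, 0 < A x * B x := by
    intro i
    induction i using Fin.lastCases with
    | last =>
      obtain ⟨x, hx, hxa⟩ := (htop.and (eventually_all.2 fun j => eventually_gt_atTop (a j))).exists
      exact ⟨x, fun j => ⟨fun _ => hxa j, fun h => absurd h (not_le.2 (Fin.castSucc_lt_last j))⟩,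
        hx⟩
    | cast i =>
      have h1 := eventually_pos_nhdsLT (hAB (a i)) (by simp [ha0]) (hneg i)
      have h2 : ∀ᶠ x in 𝓝[<] a i, ∀ j < i, a j < x :=
        eventually_all.2 fun j => eventually_imp_distrib_left.2 fun hj =>
          nhdsWithin_le_nhds (eventually_gt_nhds (ha hj))
      obtain ⟨x, ⟨hx1, hx2⟩, hx3⟩ := ((h1.and h2).and self_mem_nhdsWithin).exists
      exact ⟨x, fun j => ⟨fun hj => hx2 j (by simpa using hj), fun hj =>
        lt_of_lt_of_le hx3 (ha.monotone (by simpa using hj))⟩, hx1⟩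
  have hleft : ∀ i, ∃ x ∈ gap a i, A x * B x < 0 := by
    intro i
    induction i using Fin.cases with
    | zero =>
      obtain ⟨x, hx, hxa⟩ := (hbot.and (eventually_all.2 fun j => eventually_lt_atBot (a j))).exists
      exact ⟨x, fun j => ⟨fun h => absurd h (Fin.not_lt_zero _), fun _ => hxa j⟩, hx⟩
    | succ i =>
      have h1 := eventually_neg_nhdsGT (hAB (a i)) (by simp [ha0]) (hneg i)
      have h2 : ∀ᶠ x in 𝓝[>] a i, ∀ j, i < j → x < a j :=
        eventually_all.2 fun j => eventually_imp_distrib_left.2 fun hj =>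
          nhdsWithin_le_nhds (eventually_lt_nhds (ha hj))
      obtain ⟨x, ⟨hx1, hx2⟩, hx3⟩ := ((h1.and h2).and self_mem_nhdsWithin).exists
      refine ⟨x, fun j => ⟨fun hj => lt_of_le_of_lt (ha.monotone ?_) hx3, fun hj => hx2 j ?_⟩, hx1⟩
      · exact Fin.castSucc_lt_succ_iff.1 hj
      · exact Fin.succ_le_castSucc_iff.1 hj
  -- `A * B` is negative near the left end of each gap and positive near its right end; since `A`
  -- does not vanish inside, `B` must.
  have hzero : ∀ i, ∃ x ∈ gap a i, B x = 0 := by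
    intro i
    obtain ⟨x, hx, hx'⟩ := hleft i
    obtain ⟨y, hy, hy'⟩ := hright i
    have hcont : ContinuousOn (fun t => A t * B t) (gap a i) :=
      fun t _ => (hAB t).continuousAt.continuousWithinAt
    obtain ⟨t, ht, ht0⟩ := (ordConnected_gap a i).isPreconnected.intermediate_value hx hy hcont
      ⟨hx'.le, hy'.le⟩
    exact ⟨t, ht, (mul_eq_zero.1 ht0).resolve_left (hne i t ht)⟩
  -- On a gap the derivative of `B / A` is the Wronskian expression over `A ^ 2`, which is positive,
  -- so Rolle excludes a second zero.
  have huniq : ∀ i, ∀ x ∈ gap a i, ∀ y ∈ gap a i, B x = 0 → B y = 0 → ¬ x < y := by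
    intro i x hx y hy hBx hBy hxy
    have hmem : ∀ t ∈ Set.Icc x y, A t ≠ 0 := fun t ht =>
      hne i t ((ordConnected_gap a i).out hx hy ht)
    have hd : ∀ t ∈ Set.Icc x y,
        HasDerivAt (fun t => B t / A t) ((B' t * A t - B t * A' t) / A t ^ 2) t :=
      fun t ht => (hB t).div (hA t) (hmem t ht)
    obtain ⟨c, hc, hc0⟩ := exists_hasDerivAt_eq_zero hxy
      (fun t ht => (hd t ht).continuousAt.continuousWithinAt) (by simp [hBx, hBy])
      fun t ht => hd t (Set.Ioo_subset_Icc_self ht)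
    have hcA := hmem c (Set.Ioo_subset_Icc_self hc)
    have := hW c
    rw [div_eq_zero_iff] at hc0
    rcases hc0 with h | h
    · linarith
    · exact hcA (by simpa using h)
  choose b hb hb0 using hzero
  have hba : ∀ i : Fin N, b i.castSucc < a i ∧ a i < b i.succ := fun i =>
    ⟨(hb i.castSucc i).2 le_rfl, (hb i.succ i).1 (Fin.castSucc_lt_succ (i := i))⟩
  refine ⟨b, Fin.strictMono_iff_lt_succ.2 fun i => (hba i).1.trans (hba i).2, ?_, hba⟩
  ext x
  constructor
  · rintro ⟨i, rfl⟩
    exact hb0 i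
  · intro hx
    have hxA : x ∉ Set.range a := by
      rw [hrange]
      intro h0
      have := hW x
      rw [show A x = 0 from h0, show B x = 0 from hx] at this
      simp at this
    obtain ⟨i, hi⟩ := exists_mem_gap ha hxA
    exact ⟨i, le_antisymm (not_lt.1 (huniq i x hi _ (hb i) hx (hb0 i)))
      (not_lt.1 (huniq i _ (hb i) x hi (hb0 i) hx))⟩

end Interlacing

end MOP

namespace MOP

/-! ### Sylvester's identity for Wronskians of polynomials -/

section Wronskian

/-- Sylvester's determinant identity for two bordering rows and columns. -/
theorem det_fromBlocks_mul_det {K n : Type*} [Field K] [Fintype n] [DecidableEq n]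
    (A : Matrix n n K) (B : Matrix n (Fin 2) K) (C : Matrix (Fin 2) n K)
    (D : Matrix (Fin 2) (Fin 2) K) (hA : A.det ≠ 0)
    (minor : Fin 2 → Fin 2 → K)
    (hminor : ∀ i j, minor i j = (Matrix.fromBlocks A (B.submatrix id fun _ : Fin 1 => j)
      (C.submatrix (fun _ : Fin 1 => i) id) (Matrix.of fun _ _ => D i j)).det) :
    A.det * (Matrix.fromBlocks A B C D).det =
      minor 0 0 * minor 1 1 - minor 0 1 * minor 1 0 := by
  let _ : Invertible A := A.invertibleOfIsUnitDet (isUnit_iff_ne_zero.2 hA)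
  -- Each minor is `A.det` times one entry of the 2 × 2 Schur complement of `A`.
  have h : ∀ i j, minor i j = A.det * (D - C * ⅟A * B) i j := by
    intro i j
    rw [hminor, Matrix.det_fromBlocks₁₁, Matrix.det_unique (n := Fin 1)]
    simp [Matrix.mul_apply, Matrix.sub_apply]
  simp only [h]
  rw [Matrix.det_fromBlocks₁₁, Matrix.det_fin_two]
  ring

theorem derivative_det {R n : Type*} [CommRing R] [Fintype n] [DecidableEq n]
    (M : Matrix n n R[X]) :
    derivative M.det = ∑ i, (M.updateRow i fun j => derivative (M i j)).det := by
  have h : ∀ i, (M.updateRow i fun j => derivative (M i j)).det =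
      ∑ σ : Equiv.Perm n, ((Equiv.Perm.sign σ : ℤ) : R[X]) *
        ((∏ k ∈ Finset.univ.erase i, M k (σ k)) * derivative (M i (σ i))) := by
    intro i
    rw [← Matrix.det_transpose, Matrix.det_apply']
    refine Finset.sum_congr rfl fun σ _ => ?_
    rw [← Finset.prod_erase_mul _ _ (Finset.mem_univ i)]
    congr 2
    · refine Finset.prod_congr rfl fun k hk => ?_
      rw [Matrix.transpose_apply, Matrix.updateRow_ne (Finset.ne_of_mem_erase hk)]
    · rw [Matrix.transpose_apply, Matrix.updateRow_self]
  simp only [h]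
  rw [Finset.sum_comm, ← Matrix.det_transpose, Matrix.det_apply', derivative_sum]
  refine Finset.sum_congr rfl fun σ _ => ?_
  rw [← Finset.mul_sum, derivative_mul, derivative_intCast, zero_mul, zero_add, derivative_prod_finset]
  rfl

/-- Differentiating any row except the last reproduces the row below it, so only one term of the
row-wise product rule survives. -/
theorem derivative_wronskian {k : ℕ} (f : Fin (k + 1) → ℝ[X]) :
    derivative (wronskian f) = (Matrix.of fun i j : Fin (k + 1) =>
      derivative^[if i = Fin.last k then k + 1 else (i : ℕ)] (f j)).det := by
  rw [wronskian, derivative_det, Finset.sum_eq_single (Fin.last k)]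
  · congr 1
    ext1 i j
    by_cases hi : i = Fin.last k
    · subst hi
      simp [Function.iterate_succ_apply']
    · rw [Matrix.updateRow_ne hi]
      simp [hi]
  · intro i _ hi
    obtain ⟨i, rfl⟩ := Fin.exists_castSucc_eq.2 hi
    refine Matrix.det_zero_of_row_eq (Fin.castSucc_lt_succ (i := i)).ne ?_
    rw [Matrix.updateRow_self, Matrix.updateRow_ne (Fin.castSucc_lt_succ (i := i)).ne']
    ext1 j
    simp [← Function.iterate_succ_apply' (⇑derivative)]
  · simp

theorem eval_det_of {n : Type*} [Fintype n] [DecidableEq n] (x : ℝ) (M : n → n → ℝ[X]) :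
    (Matrix.of M).det.eval x = (Matrix.of fun i j => (M i j).eval x).det := by
  rw [← coe_evalRingHom, RingHom.map_det]
  rfl

/-- Sylvester's identity with `u`, `v` as bordering columns and the derivatives of orders `k`, `k +
1` as bordering rows. By `derivative_wronskian`, the derivative of a Wronskian is the minor that
uses row `k + 1` in place of row `k`. -/
theorem wronskian_append_mul {k : ℕ} (h : Fin k → ℝ[X]) (u v : ℝ[X]) (x : ℝ)
    (hx : (wronskian h).eval x ≠ 0) :
    (wronskian (Fin.append h ![u])).eval x * (derivative (wronskian (Fin.append h ![v]))).eval x -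
      (derivative (wronskian (Fin.append h ![u]))).eval x * (wronskian (Fin.append h ![v])).eval x =
    (wronskian h).eval x * (wronskian (Fin.append h ![u, v])).eval x := by
  set A : Matrix (Fin k) (Fin k) ℝ := Matrix.of fun i j => (derivative^[(i : ℕ)] (h j)).eval x
  set B : Matrix (Fin k) (Fin 2) ℝ :=
    Matrix.of fun i j => (derivative^[(i : ℕ)] (![u, v] j)).eval x
  set C : Matrix (Fin 2) (Fin k) ℝ :=
    Matrix.of fun i j => (derivative^[k + (i : ℕ)] (h j)).eval x
  set D : Matrix (Fin 2) (Fin 2) ℝ :=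
    Matrix.of fun i j => (derivative^[k + (i : ℕ)] (![u, v] j)).eval x
  have hA : (wronskian h).eval x = A.det := eval_det_of _ _
  have hM : (wronskian (Fin.append h ![u, v])).eval x = (Matrix.fromBlocks A B C D).det := by
    rw [wronskian, eval_det_of, ← Matrix.det_submatrix_equiv_self finSumFinEquiv]
    congr 1
    ext (i | i) (j | j) <;> simp [A, B, C, D]
  have h0 : ∀ j, (wronskian (Fin.append h ![![u, v] j])).eval x =
      (Matrix.fromBlocks A (B.submatrix id fun _ : Fin 1 => j)
      (C.submatrix (fun _ : Fin 1 => 0) id) (Matrix.of fun _ _ => D 0 j)).det := by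
    intro t
    rw [wronskian, eval_det_of, ← Matrix.det_submatrix_equiv_self finSumFinEquiv]
    congr 1
    ext (i | i) (j | j) <;> simp [A, B, C, D]
  have h1 : ∀ j, (derivative (wronskian (Fin.append h ![![u, v] j]))).eval x =
      (Matrix.fromBlocks A (B.submatrix id fun _ : Fin 1 => j)
      (C.submatrix (fun _ : Fin 1 => 1) id) (Matrix.of fun _ _ => D 1 j)).det := by
    intro t
    rw [derivative_wronskian, eval_det_of, ← Matrix.det_submatrix_equiv_self finSumFinEquiv]
    have hlast : ∀ i : Fin k, Fin.castAdd 1 i ≠ Fin.last k := fun i => (Fin.castSucc_lt_last i).ne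
    have hlast' : ∀ i : Fin 1, Fin.natAdd k i = Fin.last k := fun i => by
      ext
      simp
    have happ : Fin.append h ![![u, v] t] (Fin.last k) = ![u, v] t := by
      rw [← hlast' 0, Fin.append_right]
      simp
    congr 1
    ext (i | i) (j | j) <;> simp [A, B, C, D, hlast, hlast', happ]
  have key := det_fromBlocks_mul_det A B C D (hA ▸ hx) (fun i j => if i = 0
    then (wronskian (Fin.append h ![![u, v] j])).eval x
    else (derivative (wronskian (Fin.append h ![![u, v] j]))).eval x) (fun i j => by
      fin_cases i
      · simpa using h0 j
      · simpa using h1 j)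
  rw [hA, hM, key]
  simp
  ring

theorem wronskian_comp_perm {l : ℕ} (f : Fin l → ℝ[X]) (σ : Equiv.Perm (Fin l))
    (hσ : Equiv.Perm.sign σ = 1) : wronskian (f ∘ σ) = wronskian f := by
  have := Matrix.det_permute' σ (Matrix.of fun i j : Fin l => derivative^[(i : ℕ)] (f j))
  rw [hσ, Units.val_one, Int.cast_one, one_mul] at this
  exact this

/-- To reach the shape of `wronskian_append_mul`, `F 0` is moved past the `k` common functions. The
sign of this move is `(-1) ^ k`, which is why `k` is taken even. -/
theorem wronskian_mul_derivative_sub {k : ℕ} (hk : Even k) (F : ℕ → ℝ[X]) (x : ℝ)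
    (hx : (wronskian fun i : Fin k => F (i + 1)).eval x ≠ 0) :
    (wronskian fun i : Fin (k + 1) => F i).eval x *
        (derivative (wronskian fun i : Fin (k + 1) => F (i + 1))).eval x -
      (derivative (wronskian fun i : Fin (k + 1) => F i)).eval x *
        (wronskian fun i : Fin (k + 1) => F (i + 1)).eval x =
    (wronskian fun i : Fin k => F (i + 1)).eval x *
      (wronskian fun i : Fin (k + 2) => F i).eval x := by
  have h1 : (wronskian fun i : Fin (k + 1) => F i) =
      wronskian (Fin.append (fun i : Fin k => F (i + 1)) ![F 0]) := by
    rw [← wronskian_comp_perm _ (Fin.cycleRange (Fin.last k))]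
    · congr 1
      ext1 i
      refine Fin.addCases (fun i => ?_) (fun i => ?_) i
      · have hlt : Fin.castAdd 1 i < Fin.last k := Fin.castSucc_lt_last i
        rw [Fin.append_left, Function.comp_apply, Fin.coe_cycleRange_of_lt hlt]
        simp
      · have heq : Fin.natAdd k i = Fin.last k := by
          ext
          simp
        rw [Fin.append_right, Function.comp_apply, Fin.cycleRange_of_eq heq]
        simp
    · rw [Fin.sign_cycleRange]
      simpa using hk.neg_one_pow
  have h2 : (wronskian fun i : Fin (k + 1) => F (i + 1)) =
      wronskian (Fin.append (fun i : Fin k => F (i + 1)) ![F (k + 1)]) := by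
    congr 1
    ext1 i
    refine Fin.addCases (fun i => ?_) (fun i => ?_) i <;> simp
  have h3 : (wronskian fun i : Fin (k + 2) => F i) =
      wronskian (Fin.append (fun i : Fin k => F (i + 1)) ![F 0, F (k + 1)]) := by
    rw [← wronskian_comp_perm _ (Fin.cycleRange (Fin.last k).castSucc)]
    · congr 1
      ext1 i
      refine Fin.addCases (m := k) (n := 2) (fun i => ?_) (fun i => ?_) i
      · have hlt : Fin.castAdd 2 i < (Fin.last k).castSucc := by simp [Fin.lt_def]
        rw [Fin.append_left, Function.comp_apply, Fin.coe_cycleRange_of_lt hlt]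
        simp
      · rw [Fin.append_right, Function.comp_apply]
        match i with
        | 0 =>
          rw [Fin.cycleRange_of_eq (by ext; simp)]
          simp
        | 1 =>
          rw [Fin.cycleRange_of_gt (by simp [Fin.lt_def])]
          simp
    · rw [Fin.sign_cycleRange]
      simpa using hk.neg_one_pow
  rw [h1, h2, h3]
  exact wronskian_append_mul _ _ _ x hx

end Wronskian

end MOP

namespace MOP

variable {r : ℕ}

/-- Continuous weights with finite moments on an interval that form an AT system for every
multi-index. -/
structure IsATWeights (I : Set ℝ) (w : Fin r → ℝ → ℝ) : Prop where
  pos : 0 < r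
  ordConnected : I.OrdConnected
  continuousOn : ∀ j, ContinuousOn (w j) I
  integrableOn : ∀ (j : Fin r) (k : ℕ), IntegrableOn (fun x => x ^ k * w j x) I
  isATSystem : ∀ n : Fin r → ℕ, IsATSystem I w n

/-! ### Constant sign of the product of determinants -/

section Sign

variable {I : Set ℝ} {w : Fin r → ℝ → ℝ}

/-- On at most one point the space of functions has dimension at most `1`, too small for the
independent pair `w`, `x w`. -/
theorem IsATWeights.nontrivial (h : IsATWeights I w) : I.Nontrivial := by
  by_contra hI
  rw [Set.not_nontrivial_iff] at hI
  have : Subsingleton I := hI.coe_sort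
  let _ : Fintype I := Fintype.ofFinite I
  have hli := (h.isATSystem (Pi.single ⟨0, h.pos⟩ 2)).linearIndependent
  have hcard := hli.fintype_card_le_finrank
  rw [Module.finrank_fintype_fun_eq_card, Fintype.card_sigma] at hcard
  simp only [Fintype.card_fin, Finset.sum_pi_single', Finset.mem_univ, if_true] at hcard
  have := Fintype.card_le_one_iff_subsingleton.2 this
  omega

theorem IsATWeights.infinite_interior_diff (h : IsATWeights I w) (z : ℝ) :
    (interior I \ {z}).Infinite := by
  obtain ⟨a, ha, b, hb, hab⟩ := h.nontrivial.exists_lt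
  have hsub : Set.Ioo a b ⊆ interior I :=
    interior_maximal (Set.Ioo_subset_Icc_self.trans (h.ordConnected.out ha hb)) isOpen_Ioo
  exact ((Set.Ioo_infinite hab).mono hsub).sdiff (Set.finite_singleton z)

theorem exists_strictMono_mem {s : Set ℝ} (hs : s.Infinite) (N : ℕ) :
    ∃ x : Fin N → ℝ, StrictMono x ∧ ∀ i, x i ∈ s := by
  obtain ⟨t, hts, htc⟩ := hs.exists_subset_card_eq N
  exact ⟨t.orderEmbOfFin htc, (t.orderEmbOfFin htc).strictMono,
    fun i => hts (t.orderEmbOfFin_mem htc i)⟩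

/-- A linear relation among the rows is a nontrivial combination of the `g_i` that vanishes at all
the `|n|` distinct points `x j`, one zero too many. -/
theorem IsATWeights.det_gFun_ne_zero (h : IsATWeights I w) (n : Fin r → ℕ)
    {x : Fin (size n) → ℝ} (hx : x ∈ cube I (size n)) (hinj : Function.Injective x) :
    (Matrix.of fun i j : Fin (size n) => gFun w n i (x j)).det ≠ 0 := by
  intro h0
  obtain ⟨v, hv, hv0⟩ := Matrix.exists_vecMul_eq_zero_iff.2 h0
  set c : (Σ j : Fin r, Fin (n j)) → ℝ := fun p => v (finSigmaFinEquiv p) with hc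
  have hc0 : c ≠ 0 := by
    intro hc0
    refine hv (funext fun i => ?_)
    have := congrFun hc0 (finSigmaFinEquiv.symm i)
    simp only [hc] at this
    erw [Equiv.apply_symm_apply] at this
    exact this
  have hlt := (h.isATSystem n).zeros_lt c hc0
  have hsub : Set.range x ⊆ {t ∈ I | ∑ p, c p * weightFamily w n p t = 0} := by
    rintro _ ⟨j, rfl⟩
    refine ⟨hx j (Set.mem_univ j), ?_⟩
    have := congrFun hv0 j
    simp only [Matrix.vecMul, dotProduct, Matrix.of_apply, gFun, Pi.zero_apply] at this
    rw [← this]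
    refine (Fintype.sum_equiv finSigmaFinEquiv.symm _ _ fun i => ?_).symm
    simp only [hc]
    erw [Equiv.apply_symm_apply]
  have hle := hinj.encard_range.trans (Set.encard_le_encard hsub)
  rw [ENat.card_eq_coe_fintype_card, Fintype.card_fin] at hle
  have hcard : Fintype.card (Σ j : Fin r, Fin (n j)) = size n := by
    simp [Fintype.card_sigma, size]
  rw [hcard] at hlt
  exact absurd hlt (not_lt.2 hle)

theorem detProduct_comp_perm (w : Fin r → ℝ → ℝ) (n : Fin r → ℕ) (x : Fin (size n) → ℝ)
    (σ : Equiv.Perm (Fin (size n))) : detProduct w n (x ∘ σ) = detProduct w n x := by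
  have h1 := Matrix.det_permute' σ (Matrix.of fun i j : Fin (size n) => x j ^ (i : ℕ))
  have h2 := Matrix.det_permute' σ (Matrix.of fun i j : Fin (size n) => gFun w n i (x j))
  have e1 : detProduct w n (x ∘ σ) =
      ((Matrix.of fun i j : Fin (size n) => x j ^ (i : ℕ)).submatrix id σ).det *
        ((Matrix.of fun i j : Fin (size n) => gFun w n i (x j)).submatrix id σ).det := rfl
  rw [e1, h1, h2, detProduct]
  rcases Int.units_eq_one_or (Equiv.Perm.sign σ) with h | h <;> simp [h]

theorem detProduct_eq_zero (w : Fin r → ℝ → ℝ) (n : Fin r → ℕ) {x : Fin (size n) → ℝ}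
    (hx : ¬ Function.Injective x) : detProduct w n x = 0 := by
  simp only [Function.Injective, not_forall] at hx
  obtain ⟨i, j, hij, hne⟩ := hx
  rw [detProduct, Matrix.det_zero_of_column_eq hne (by simp [hij]), zero_mul]

theorem det_pow_pos {N : ℕ} {x : Fin N → ℝ} (hx : StrictMono x) :
    0 < (Matrix.of fun i j : Fin N => x j ^ (i : ℕ)).det := by
  have : (Matrix.of fun i j : Fin N => x j ^ (i : ℕ)) = (Matrix.vandermonde x).transpose := rfl
  rw [this, Matrix.det_transpose, Matrix.det_vandermonde]
  exact Finset.prod_pos fun i _ => Finset.prod_pos fun j hj =>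
    sub_pos.2 (hx (Finset.mem_Ioi.1 hj))

/-- The strictly increasing points of the cube form a convex set, on which the nonvanishing
continuous `G` keeps its sign and the Vandermonde factor is positive. The product is symmetric, so
sorting extends this to all injective points. -/
theorem IsATWeights.exists_sign (h : IsATWeights I w) (n : Fin r → ℕ) :
    ∃ s : ℝ, ∀ x ∈ cube I (size n), Function.Injective x → 0 < s * detProduct w n x := by
  set G : (Fin (size n) → ℝ) → ℝ := fun x =>
    (Matrix.of fun i j : Fin (size n) => gFun w n i (x j)).det with hG
  set S : Set (Fin (size n) → ℝ) := {x ∈ cube I (size n) | StrictMono x} with hS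
  have hconv : Convex ℝ S := by
    refine (convex_pi fun i _ => h.ordConnected.convex).inter ?_
    intro x hx y hy a b ha hb hab i j hij
    have hx' := hx hij
    have hy' := hy hij
    simp only [Pi.add_apply, Pi.smul_apply, smul_eq_mul]
    rcases ha.eq_or_lt with rfl | ha
    · rw [zero_add] at hab
      subst hab
      simpa using hy'
    · nlinarith [mul_lt_mul_of_pos_left hx' ha, mul_le_mul_of_nonneg_left hy'.le hb]
  have hcont : ContinuousOn G S := by
    refine (continuous_id.matrix_det).comp_continuousOn ?_
    refine continuousOn_pi.2 fun i => continuousOn_pi.2 fun j => ?_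
    have hj : ContinuousOn (fun x : Fin (size n) → ℝ => x j) S := (continuous_apply j).continuousOn
    exact (hj.pow _).mul ((h.continuousOn _).comp hj fun x hx => hx.1 j (Set.mem_univ j))
  obtain ⟨x₀, hx₀, hx₀I⟩ := exists_strictMono_mem (h.infinite_interior_diff 0) (size n)
  have hx₀S : x₀ ∈ S := ⟨fun i _ => interior_subset (hx₀I i).1, hx₀⟩
  have hne : ∀ x ∈ S, G x ≠ 0 := fun x hx => h.det_gFun_ne_zero n hx.1 hx.2.injective
  have hpos : ∀ x ∈ S, 0 < G x₀ * G x := by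
    intro x hx
    by_contra hlt
    push Not at hlt
    obtain ⟨y, hy, hy0⟩ := hconv.isPreconnected.intermediate_value hx hx₀S
      (continuousOn_const.mul hcont : ContinuousOn (fun y => G x₀ * G y) S)
      ⟨hlt, (mul_self_pos.2 (hne _ hx₀S)).le⟩
    exact mul_ne_zero (hne _ hx₀S) (hne _ hy) hy0
  refine ⟨G x₀, fun x hx hinj => ?_⟩
  have hmono : StrictMono (x ∘ Tuple.sort x) :=
    (Tuple.monotone_sort x).strictMono_of_injective (hinj.comp (Equiv.injective _))
  rw [← detProduct_comp_perm w n x (Tuple.sort x), detProduct, mul_left_comm]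
  exact mul_pos (det_pow_pos hmono) (hpos _ ⟨fun i _ => hx _ (Set.mem_univ _), hmono⟩)

theorem IsATWeights.measurableSet_cube (h : IsATWeights I w) (N : ℕ) :
    MeasurableSet (cube I N) :=
  MeasurableSet.univ_pi fun _ => h.ordConnected.measurableSet

/-- Increasing points of the interior of `I` that avoid `z` form a nonempty open set. Excluding `z`
allows integrands with a factor `∏ (z - x k) ^ m`. -/
theorem IsATWeights.setIntegral_cube_pos (h : IsATWeights I w) {N : ℕ} (z : ℝ)
    {f : (Fin N → ℝ) → ℝ} (hf : IntegrableOn f (cube I N)) (hnonneg : ∀ x ∈ cube I N, 0 ≤ f x)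
    (hpos : ∀ x ∈ cube I N, StrictMono x → (∀ k, x k ≠ z) → 0 < f x) :
    0 < ∫ x in cube I N, f x := by
  rw [setIntegral_pos_iff_support_of_nonneg_ae
    (ae_restrict_of_forall_mem (h.measurableSet_cube N) hnonneg) hf]
  set U : Set (Fin N → ℝ) :=
    (⋂ i, ⋂ j, ⋂ _ : i < j, {x | x i < x j}) ∩ Set.univ.pi fun _ => interior I \ {z} with hU
  have hmem : ∀ x, x ∈ U ↔ StrictMono x ∧ ∀ k, x k ∈ interior I \ {z} := fun x => by
    simp [hU, StrictMono]
  have hopen : IsOpen U := by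
    refine IsOpen.inter ?_ (isOpen_set_pi Set.finite_univ fun _ _ =>
      isOpen_interior.sdiff isClosed_singleton)
    exact isOpen_iInter_of_finite fun i => isOpen_iInter_of_finite fun j =>
      isOpen_iInter_of_finite fun _ => isOpen_lt (continuous_apply i) (continuous_apply j)
  have hne : U.Nonempty := by
    obtain ⟨x, hx⟩ := exists_strictMono_mem (h.infinite_interior_diff z) N
    exact ⟨x, (hmem x).2 hx⟩
  refine (hopen.measure_pos volume hne).trans_le (measure_mono fun x hx => ?_)
  obtain ⟨hx1, hx2⟩ := (hmem x).1 hx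
  have hxc : x ∈ cube I N := fun k _ => interior_subset (hx2 k).1
  exact ⟨(hpos x hxc hx1 fun k => (hx2 k).2).ne', hxc⟩

end Sign

end MOP

namespace MOP

variable {r : ℕ} {I : Set ℝ} {w : Fin r → ℝ → ℝ} {𝕜 : Type} [RCLike 𝕜]

/-! ### Integrals over the cube as determinants -/

section Integrals

theorem ofReal_det {n : Type*} [Fintype n] [DecidableEq n] (M : n → n → ℝ) :
    (((Matrix.of M).det : ℝ) : 𝕜) = (Matrix.of fun i j => (M i j : 𝕜)).det := by
  rw [← RCLike.algebraMap_eq_ofReal, RingHom.map_det]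
  rfl

theorem IsATWeights.integrable_eval_mul_gFun (h : IsATWeights I w) (n : Fin r → ℕ) (p : 𝕜[X])
    (k : Fin (size n)) :
    Integrable (fun t : ℝ => p.eval (t : 𝕜) * (gFun w n k t : 𝕜)) (volume.restrict I) := by
  simp only [eval_eq_sum_range, Finset.sum_mul]
  refine integrable_finsetSum _ fun e _ => ?_
  have := ((h.integrableOn (finSigmaFinEquiv.symm k).1
    (e + (finSigmaFinEquiv.symm k).2)).ofReal (𝕜 := 𝕜)).const_mul (p.coeff e)
  refine this.congr (ae_of_all _ fun t => ?_)
  simp only [gFun, weightFamily]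
  push_cast
  ring

theorem charPow_mul_detProduct {m : ℕ} (w : Fin r → ℝ → ℝ) (n : Fin r → ℕ) (z : 𝕜)
    (q : Fin (size n) ⊕ Fin m → 𝕜[X]) (hdeg : ∀ i, (q i).natDegree = finSumFinEquiv i)
    (hq : ∀ i, (q i).Monic) (x : Fin (size n) → ℝ) :
    charPow (size n) m z x * (detProduct w n x : 𝕜) =
      (Matrix.of fun i c => Sum.elim (fun j => (q i).eval (x j : 𝕜))
        (fun l : Fin m => (taylor z (q i)).coeff l) c).det *
      (Matrix.of fun i j => (gFun w n i (x j) : 𝕜)).det := by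
  have h1 := det_confluent (fun j => (x j : 𝕜)) z q hdeg hq
  have h2 : (Matrix.of fun i c => confluentFunctional (fun j => (x j : 𝕜)) z c (q i)) =
      Matrix.of fun i c => Sum.elim (fun j => (q i).eval (x j : 𝕜))
        (fun l : Fin m => (taylor z (q i)).coeff l) c := by
    ext i (j | j) <;> simp [confluentFunctional]
  rw [← h2, h1, charPow, detProduct, RCLike.ofReal_mul, ofReal_det, ofReal_det]
  simp only [RCLike.ofReal_pow]
  ring

theorem restrict_cube (I : Set ℝ) (N : ℕ) :
    volume.restrict (cube I N) = Measure.pi fun _ : Fin N => volume.restrict I := by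
  rw [volume_pi, cube, Measure.restrict_pi_pi]

theorem IsATWeights.integrableOn_charPow_mul_detProduct (h : IsATWeights I w) (n : Fin r → ℕ)
    (m : ℕ) (z : 𝕜) :
    IntegrableOn (fun x => charPow (size n) m z x * (detProduct w n x : 𝕜)) (cube I (size n)) := by
  rw [IntegrableOn, restrict_cube]
  simp only [charPow_mul_detProduct w n z
    (fun i : Fin (size n) ⊕ Fin m => X ^ (finSumFinEquiv i : ℕ)) (by simp) fun _ => monic_X_pow _]
  exact integrable_det_mul_det _ (fun (i : Fin (size n) ⊕ Fin m) (t : ℝ) =>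
    (X ^ (finSumFinEquiv i : ℕ) : 𝕜[X]).eval (t : 𝕜)) _ (fun k t => (gFun w n k t : 𝕜))
    fun i k => h.integrable_eval_mul_gFun n _ k

/-- The matrix of the integrals `∫ t ^ i * g k t`. -/
noncomputable def gram (I : Set ℝ) (w : Fin r → ℝ → ℝ) (n : Fin r → ℕ) :
    Matrix (Fin (size n)) (Fin (size n)) ℝ :=
  Matrix.of fun i k => ∫ t in I, t ^ (i : ℕ) * gFun w n k t

/-- With rows `X ^ i` followed by `P j`, orthogonality annihilates the lower left block after
integration, and the determinant splits. -/
theorem IsATWeights.integral_charPow_mul_detProduct (h : IsATWeights I w) (n : Fin r → ℕ)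
    {m : ℕ} (P : Fin m → ℝ[X]) (hdeg : ∀ j, (P j).natDegree = size n + j)
    (hP : ∀ j, (P j).Monic) (horth : ∀ j k, ∫ t in I, (P j).eval t * gFun w n k t = 0) (z : 𝕜) :
    ∫ x in cube I (size n), charPow (size n) m z x * (detProduct w n x : 𝕜) =
      (size n).factorial * ((gram I w n).det : 𝕜) *
        (Matrix.of fun j l : Fin m => (taylor z ((P j).map (algebraMap ℝ 𝕜))).coeff l).det := by
  set q : Fin (size n) ⊕ Fin m → 𝕜[X] :=
    Sum.elim (fun i => X ^ (i : ℕ)) fun j => (P j).map (algebraMap ℝ 𝕜) with hq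
  have hqdeg : ∀ i, (q i).natDegree = finSumFinEquiv i := by
    rintro (i | j)
    · simp [hq]
    · simp [hq, hdeg]
  have hqm : ∀ i, (q i).Monic := by
    rintro (i | j)
    · simp [hq]
    · exact (hP j).map _
  rw [restrict_cube]
  simp only [charPow_mul_detProduct w n z q hqdeg hqm]
  rw [integral_det_mul_det _ (fun i (t : ℝ) => (q i).eval (t : 𝕜)) _
    (fun k t => (gFun w n k t : 𝕜)) fun i k => h.integrable_eval_mul_gFun n _ k,
    Fintype.card_fin, mul_assoc, gram, ofReal_det]
  congr 1
  rw [← Matrix.det_fromBlocks_zero₂₁ _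
    (Matrix.of fun (i : Fin (size n)) (l : Fin m) => (taylor z (X ^ (i : ℕ) : 𝕜[X])).coeff l)]
  congr 1
  have hreal : ∀ (p : ℝ[X]) k,
      ∫ t in I, (p.map (algebraMap ℝ 𝕜)).eval (t : 𝕜) * (gFun w n k t : 𝕜) =
        ((∫ t in I, p.eval t * gFun w n k t : ℝ) : 𝕜) := by
    intro p k
    rw [← integral_ofReal]
    refine integral_congr_ae (ae_of_all _ fun t => ?_)
    simp only [RCLike.ofReal_mul]
    rw [← RCLike.algebraMap_eq_ofReal, eval_map_algebraMap, aeval_algebraMap_apply]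
    simp
  ext (i | i) (j | j)
  · have := hreal (X ^ (i : ℕ)) j
    simpa [hq] using this
  · simp [hq]
  · have := hreal (P i) j
    rw [horth, RCLike.ofReal_zero] at this
    simpa [hq] using this
  · simp [hq]

end Integrals

/-! ### The probability density and even moments -/

section Density

theorem IsATWeights.integrableOn_detProduct (h : IsATWeights I w) (n : Fin r → ℕ) :
    IntegrableOn (detProduct w n) (cube I (size n)) := by
  simpa [charPow] using h.integrableOn_charPow_mul_detProduct n 0 (0 : ℝ)

theorem IsATWeights.exists_sign_normConst (h : IsATWeights I w) (n : Fin r → ℕ) :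
    ∃ s : ℝ, (∀ x ∈ cube I (size n), Function.Injective x → 0 < s * detProduct w n x) ∧
      0 < s * normConst I w n := by
  obtain ⟨s, hs⟩ := h.exists_sign n
  refine ⟨s, hs, ?_⟩
  rw [normConst, ← integral_const_mul]
  refine h.setIntegral_cube_pos 0 ((h.integrableOn_detProduct n).const_mul s) (fun x hx => ?_)
    fun x hx hmono _ => hs x hx hmono.injective
  by_cases hinj : Function.Injective x
  · exact (hs x hx hinj).le
  · simp [detProduct_eq_zero w n hinj]

theorem IsATWeights.normConst_ne_zero (h : IsATWeights I w) (n : Fin r → ℕ) :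
    normConst I w n ≠ 0 := by
  obtain ⟨s, -, hs⟩ := h.exists_sign_normConst n
  exact right_ne_zero_of_mul hs.ne'

theorem IsATWeights.jointDensity_pos (h : IsATWeights I w) (n : Fin r → ℕ)
    {x : Fin (size n) → ℝ} (hx : x ∈ cube I (size n)) (hinj : Function.Injective x) :
    0 < jointDensity I w n x := by
  obtain ⟨s, hs, hZ⟩ := h.exists_sign_normConst n
  have hs0 : s ≠ 0 := left_ne_zero_of_mul hZ.ne'
  have : jointDensity I w n x = (s * normConst I w n)⁻¹ * (s * detProduct w n x) := by
    rw [jointDensity, mul_inv, mul_mul_mul_comm, inv_mul_cancel₀ hs0, one_mul]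
  rw [this]
  exact mul_pos (inv_pos.2 hZ) (hs x hx hinj)

theorem IsATWeights.jointDensity_nonneg (h : IsATWeights I w) (n : Fin r → ℕ)
    {x : Fin (size n) → ℝ} (hx : x ∈ cube I (size n)) : 0 ≤ jointDensity I w n x := by
  by_cases hinj : Function.Injective x
  · exact (h.jointDensity_pos n hx hinj).le
  · simp [jointDensity, detProduct_eq_zero w n hinj]

theorem IsATWeights.integrableOn_jointDensity (h : IsATWeights I w) (n : Fin r → ℕ) :
    IntegrableOn (jointDensity I w n) (cube I (size n)) :=
  (h.integrableOn_detProduct n).const_mul _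

theorem IsATWeights.isProbabilityMeasure_ensemble (h : IsATWeights I w) (n : Fin r → ℕ) :
    IsProbabilityMeasure (ensemble I w n) := by
  refine ⟨?_⟩
  rw [ensemble, withDensity_apply _ MeasurableSet.univ, Measure.restrict_univ,
    ← ofReal_integral_eq_lintegral_ofReal (h.integrableOn_jointDensity n)
      (ae_restrict_of_forall_mem (h.measurableSet_cube _) fun x hx => h.jointDensity_nonneg n hx)]
  have : ∫ x in cube I (size n), jointDensity I w n x = 1 := by
    simp only [jointDensity]
    rw [integral_const_mul]
    exact inv_mul_cancel₀ (h.normConst_ne_zero n)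
  rw [this, ENNReal.ofReal_one]

theorem IsATWeights.integral_ensemble (h : IsATWeights I w) (n : Fin r → ℕ)
    (f : (Fin (size n) → ℝ) → 𝕜) :
    ∫ x, f x ∂(ensemble I w n) =
      ∫ x in cube I (size n), (jointDensity I w n x : 𝕜) * f x := by
  rw [ensemble, integral_withDensity_eq_integral_toReal_smul₀
    (h.integrableOn_jointDensity n).aemeasurable.ennreal_ofReal (ae_of_all _ fun _ =>
      ENNReal.ofReal_lt_top)]
  refine setIntegral_congr_fun (h.measurableSet_cube _) fun x hx => ?_
  simp only [ENNReal.toReal_ofReal (h.jointDensity_nonneg n hx), RCLike.real_smul_eq_coe_mul]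

theorem IsATWeights.integrable_ensemble_iff (h : IsATWeights I w) (n : Fin r → ℕ)
    (f : (Fin (size n) → ℝ) → 𝕜) :
    Integrable f (ensemble I w n) ↔
      IntegrableOn (fun x => (jointDensity I w n x : 𝕜) * f x) (cube I (size n)) := by
  rw [ensemble, integrable_withDensity_iff_integrable_smul₀'
    (h.integrableOn_jointDensity n).aemeasurable.ennreal_ofReal (ae_of_all _ fun _ =>
      ENNReal.ofReal_lt_top), IntegrableOn]
  refine integrable_congr (ae_restrict_of_forall_mem (h.measurableSet_cube _) fun x hx => ?_)
  simp only [ENNReal.toReal_ofReal (h.jointDensity_nonneg n hx), RCLike.real_smul_eq_coe_mul]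

theorem jointDensity_mul_charPow (n : Fin r → ℕ) (m : ℕ) (z : 𝕜) (x : Fin (size n) → ℝ) :
    (jointDensity I w n x : 𝕜) * charPow (size n) m z x =
      (normConst I w n : 𝕜)⁻¹ * (charPow (size n) m z x * (detProduct w n x : 𝕜)) := by
  simp only [jointDensity, RCLike.ofReal_mul, RCLike.ofReal_inv]
  ring

theorem IsATWeights.integrable_charPow (h : IsATWeights I w) (n : Fin r → ℕ) (m : ℕ) (z : 𝕜) :
    Integrable (charPow (size n) m z) (ensemble I w n) := by
  rw [h.integrable_ensemble_iff]
  simp only [jointDensity_mul_charPow]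
  exact (h.integrableOn_charPow_mul_detProduct n m z).const_mul _

theorem IsATWeights.moment_eq (h : IsATWeights I w) (n : Fin r → ℕ) (m : ℕ) (z : 𝕜) :
    moment I w n m z = (normConst I w n : 𝕜)⁻¹ *
      ∫ x in cube I (size n), charPow (size n) m z x * (detProduct w n x : 𝕜) := by
  rw [moment, h.integral_ensemble]
  simp only [jointDensity_mul_charPow]
  rw [integral_const_mul]

/-- The case `m = 0` of the integral formula, with no bordering rows. -/
theorem IsATWeights.normConst_eq (h : IsATWeights I w) (n : Fin r → ℕ) :
    normConst I w n = (size n).factorial * (gram I w n).det := by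
  have := h.integral_charPow_mul_detProduct n (m := 0) (fun j => j.elim0) (fun j => j.elim0)
    (fun j => j.elim0) (fun j => j.elim0) (0 : ℝ)
  simpa [charPow, normConst] using this

theorem IsATWeights.det_gram_ne_zero (h : IsATWeights I w) (n : Fin r → ℕ) :
    (gram I w n).det ≠ 0 := by
  have := h.normConst_ne_zero n
  rw [h.normConst_eq] at this
  exact right_ne_zero_of_mul this

theorem IsATWeights.moment_pos_of_even (h : IsATWeights I w) (n : Fin r → ℕ) {m : ℕ}
    (hm : Even m) (x : ℝ) : 0 < moment I w n m x := by
  rw [moment, h.integral_ensemble]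
  have hnonneg : ∀ y, 0 ≤ charPow (size n) m x y := fun y =>
    Finset.prod_nonneg fun k _ => hm.pow_nonneg _
  refine h.setIntegral_cube_pos x ((h.integrable_ensemble_iff n _).1 (h.integrable_charPow n m x))
    (fun y hy => mul_nonneg (h.jointDensity_nonneg n hy) (hnonneg y)) fun y hy hmono hne => ?_
  refine mul_pos (h.jointDensity_pos n hy hmono.injective)
    (Finset.prod_pos fun k _ => hm.pow_pos ?_)
  exact sub_ne_zero.2 (hne k).symm

end Density

end MOP

namespace MOP

variable {r : ℕ} {I : Set ℝ} {w : Fin r → ℝ → ℝ} {𝕜 : Type} [RCLike 𝕜]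

/-! ### Existence and uniqueness of type II polynomials -/

section TypeII

/-- The linear functional `P ↦ ∫ P g_k` on real polynomials. -/
noncomputable def IsATWeights.functional (h : IsATWeights I w) (n : Fin r → ℕ)
    (k : Fin (size n)) : ℝ[X] →ₗ[ℝ] ℝ where
  toFun P := ∫ t in I, P.eval t * gFun w n k t
  map_add' P Q := by
    simp only [eval_add, add_mul]
    exact integral_add (by simpa using h.integrable_eval_mul_gFun n P k)
      (by simpa using h.integrable_eval_mul_gFun n Q k)
  map_smul' c P := by
    simp only [eval_smul, smul_eq_mul, mul_assoc, RingHom.id_apply]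
    exact integral_const_mul _ _

theorem IsATWeights.functional_apply (h : IsATWeights I w) (n : Fin r → ℕ)
    (k : Fin (size n)) (P : ℝ[X]) :
    h.functional n k P = ∫ t in I, P.eval t * gFun w n k t := rfl

theorem IsATWeights.functional_sum (h : IsATWeights I w) (n : Fin r → ℕ)
    (k : Fin (size n)) (c : Fin (size n) → ℝ) :
    h.functional n k (∑ i, C (c i) * X ^ (i : ℕ)) = Matrix.vecMul c (gram I w n) k := by
  rw [map_sum]
  refine Finset.sum_congr rfl fun i _ => ?_
  rw [← smul_eq_C_mul, map_smul, functional_apply, smul_eq_mul]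
  simp [gram]

theorem orthogonal_iff (n : Fin r → ℕ) (P : ℝ[X]) :
    (∀ j : Fin r, ∀ k < n j, ∫ x in I, P.eval x * x ^ k * w j x = 0) ↔
      ∀ i : Fin (size n), ∫ x in I, P.eval x * gFun w n i x = 0 := by
  simp only [gFun, weightFamily, ← mul_assoc]
  constructor
  · exact fun h i => h _ _ (finSigmaFinEquiv.symm i).2.2
  · intro h j k hk
    have := h (finSigmaFinEquiv ⟨j, ⟨k, hk⟩⟩)
    erw [Equiv.symm_apply_apply] at this
    exact this

/-- The orthogonality conditions are a square linear system for the lower coefficients, with the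
invertible Gram matrix. -/
theorem IsATWeights.exists_isTypeII (h : IsATWeights I w) (n : Fin r → ℕ) :
    ∃ P, IsTypeII I w n P := by
  set b : Fin (size n) → ℝ := fun k => -h.functional n k (X ^ size n) with hb
  set c := Matrix.vecMul b (gram I w n)⁻¹ with hc
  have hdeg : (∑ i : Fin (size n), C (c i) * X ^ (i : ℕ)).degree < (size n : WithBot ℕ) :=
    degree_sum_fin_lt c
  refine ⟨X ^ size n + ∑ i : Fin (size n), C (c i) * X ^ (i : ℕ), monic_X_pow_add hdeg, ?_, ?_⟩
  · rw [natDegree_add_eq_left_of_degree_lt (by rwa [degree_X_pow]), natDegree_X_pow]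
  · rw [orthogonal_iff]
    intro k
    rw [← h.functional_apply, map_add, h.functional_sum, hc, Matrix.vecMul_vecMul,
      Matrix.nonsing_inv_mul _ (isUnit_iff_ne_zero.2 (h.det_gram_ne_zero n)), Matrix.vecMul_one, hb]
    exact add_neg_cancel _

theorem IsATWeights.isTypeII_unique (h : IsATWeights I w) (n : Fin r → ℕ) {P Q : ℝ[X]}
    (hP : IsTypeII I w n P) (hQ : IsTypeII I w n Q) : P = Q := by
  by_contra hne
  have h0 : P - Q ≠ 0 := sub_ne_zero.2 hne
  have hdeg : (P - Q).natDegree < size n := by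
    have := degree_sub_lt_left (p := P) (q := Q)
      (by rw [degree_eq_natDegree hP.monic.ne_zero, degree_eq_natDegree hQ.monic.ne_zero,
        hP.natDegree_eq, hQ.natDegree_eq]) hP.monic.ne_zero
      (by rw [hP.monic.leadingCoeff, hQ.monic.leadingCoeff])
    rw [← hP.natDegree_eq]
    exact natDegree_lt_natDegree h0 this
  have hsum : P - Q = ∑ i : Fin (size n), C ((P - Q).coeff i) * X ^ (i : ℕ) := by
    conv_lhs => rw [(P - Q).as_sum_range' _ hdeg, Finset.sum_range]
    simp only [C_mul_X_pow_eq_monomial]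
  have hvec : Matrix.vecMul (fun i : Fin (size n) => (P - Q).coeff i) (gram I w n) = 0 := by
    ext k
    have hPk := (orthogonal_iff n P).1 hP.orthogonal k
    have hQk := (orthogonal_iff n Q).1 hQ.orthogonal k
    rw [← h.functional_apply] at hPk hQk
    rw [← h.functional_sum, ← hsum, map_sub, hPk, hQk, sub_zero, Pi.zero_apply]
  have hzero := Matrix.eq_zero_of_vecMul_eq_zero (h.det_gram_ne_zero n) hvec
  refine h0 ?_
  rw [hsum]
  exact Finset.sum_eq_zero fun i _ => by rw [show (P - Q).coeff i = 0 from congrFun hzero i]; simp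

theorem IsATWeights.isTypeII_typeII (h : IsATWeights I w) (n : Fin r → ℕ) :
    IsTypeII I w n (typeII I w n) :=
  Classical.epsilon_spec (h.exists_isTypeII n)

end TypeII

/-! ### Moments as Wronskians -/

section WronskianFormula

/-- The derivative of order `i` at `z` is `i!` times a Taylor coefficient; the factorials come out
row by row. -/
theorem aeval_wronskian {m : ℕ} (f : Fin m → ℝ[X]) (z : 𝕜) :
    aeval z (wronskian f) = (∏ i ∈ Finset.range m, (i.factorial : 𝕜)) *
      (Matrix.of fun j l : Fin m => (taylor z ((f j).map (algebraMap ℝ 𝕜))).coeff l).det := by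
  have hentry : ∀ i j : Fin m, aeval z (derivative^[(i : ℕ)] (f j)) =
      ((i : ℕ).factorial : 𝕜) * (taylor z ((f j).map (algebraMap ℝ 𝕜))).coeff i := by
    intro i j
    rw [taylor_coeff, ← eval_map_algebraMap, ← iterate_derivative_map, ← factorial_smul_hasseDeriv]
    simp
  rw [wronskian, AlgHom.map_det, ← Matrix.det_transpose (Matrix.of fun j l : Fin m =>
    (taylor z ((f j).map (algebraMap ℝ 𝕜))).coeff l),
    Finset.prod_range (fun i => (i.factorial : 𝕜)), ← Matrix.det_mul_column]
  congr 1
  ext i j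
  exact hentry i j

theorem IsPath.le {n : Fin r → ℕ} {m : ℕ} {p : Fin m → Fin r → ℕ} (hp : IsPath n p) (j : Fin m) :
    n ≤ p j := by
  have hm : 0 < m := j.pos
  rw [← hp.start hm]
  exact hp.mono (Fin.mk_le_of_le_val (Nat.zero_le _))

theorem IsATWeights.moment_eq_wronskian (h : IsATWeights I w) (n : Fin r → ℕ) (m : ℕ)
    (p : Fin m → Fin r → ℕ) (hp : IsPath n p) (z : 𝕜) :
    moment I w n m z = (∏ i ∈ Finset.range m, (i.factorial : 𝕜))⁻¹ *
      aeval z (wronskian fun i => typeII I w (p i)) := by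
  have hT := fun j => h.isTypeII_typeII (p j)
  have hfac : (∏ i ∈ Finset.range m, (i.factorial : 𝕜)) ≠ 0 :=
    Finset.prod_ne_zero_iff.2 fun i _ => Nat.cast_ne_zero.2 i.factorial_ne_zero
  have hZ : (normConst I w n : 𝕜) ≠ 0 := RCLike.ofReal_ne_zero.2 (h.normConst_ne_zero n)
  -- Every multi-index on the path dominates `n`, so its polynomial satisfies all the orthogonality
  -- conditions for `n`.
  have hint := h.integral_charPow_mul_detProduct n (fun j => typeII I w (p j))
    (fun j => (hT j).natDegree_eq.trans (hp.size_eq j)) (fun j => (hT j).monic)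
    (fun j => (orthogonal_iff n _).1 fun i k hk =>
      (hT j).orthogonal i k (hk.trans_le (hp.le j i))) z
  have hZ' : (normConst I w n : 𝕜) = (size n).factorial * ((gram I w n).det : 𝕜) := by
    rw [h.normConst_eq]
    push_cast
    rfl
  rw [h.moment_eq, hint, ← hZ', aeval_wronskian, inv_mul_cancel_left₀ hZ,
    inv_mul_cancel_left₀ hfac]

end WronskianFormula

/-! ### Behaviour of the moments at infinity -/

section Asymptotics

open Filter Topology

/-- The quotient is the expectation of `∏ (1 - y k / x) ^ m`, and dominated convergence applies. A
general filter `l` treats `+∞` and `-∞` together. -/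
theorem IsATWeights.tendsto_moment_div_pow (h : IsATWeights I w) (n : Fin r → ℕ) (m : ℕ)
    {l : Filter ℝ} [l.IsCountablyGenerated] (hl : Tendsto (fun x : ℝ => x⁻¹) l (𝓝 0))
    (hl0 : ∀ᶠ x in l, x ≠ 0) :
    Tendsto (fun x => moment I w n m x / x ^ (size n * m)) l (𝓝 1) := by
  have := h.isProbabilityMeasure_ensemble n
  have hlim : Tendsto (fun x : ℝ => ∫ y, ∏ k, (1 - x⁻¹ * y k) ^ m ∂(ensemble I w n)) l (𝓝 1) := by
    have h1 : ∫ _, (1 : ℝ) ∂(ensemble I w n) = 1 := by simp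
    suffices hdom : Tendsto (fun x : ℝ => ∫ y, ∏ k, (1 - x⁻¹ * y k) ^ m ∂(ensemble I w n)) l
        (𝓝 (∫ _, (1 : ℝ) ∂(ensemble I w n))) by rwa [h1] at hdom
    -- For `|x⁻¹| ≤ 1` one has `|1 - y / x| ≤ 1 + |y| ≤ √2 |i - y|`, so integrability of the bound
    -- is finiteness of the moment at `z = i`.
    refine tendsto_integral_filter_of_dominated_convergence
      (fun y => ‖(√2 : ℂ) ^ (size n * m) * charPow (size n) m Complex.I y‖) ?_ ?_
      ((h.integrable_charPow n m Complex.I).const_mul _).norm ?_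
    · refine Eventually.of_forall fun x => Continuous.aestronglyMeasurable ?_
      fun_prop
    · have hsmall : ∀ᶠ x in l, |x⁻¹| ≤ 1 := by
        have := (hl.abs).eventually (eventually_le_nhds (show |(0 : ℝ)| < 1 by simp))
        exact this
      filter_upwards [hsmall] with x hx
      refine ae_of_all _ fun y => ?_
      rw [norm_mul, charPow, norm_prod, norm_prod, norm_pow, pow_mul]
      have hcard : (‖(√2 : ℂ)‖ ^ size n) ^ m = ∏ _k : Fin (size n), ‖(√2 : ℂ)‖ ^ m := by
        rw [Finset.prod_const, Finset.card_univ, Fintype.card_fin, ← pow_mul, ← pow_mul, mul_comm]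
      rw [hcard, ← Finset.prod_mul_distrib]
      refine Finset.prod_le_prod (fun k _ => norm_nonneg _) fun k _ => ?_
      rw [norm_pow, norm_pow, ← mul_pow]
      refine pow_le_pow_left₀ (norm_nonneg _) ?_ _
      have h2 : ‖Complex.I - (y k : ℂ)‖ = √(1 + y k ^ 2) := by
        rw [Complex.norm_def, Complex.normSq_apply]
        simp
        ring_nf
      have h3 : ‖(√2 : ℂ)‖ = √2 := by simp [abs_of_nonneg]
      have h4 : (RCLike.ofReal (y k) : ℂ) = (y k : ℂ) := rfl
      rw [h4, h2, h3, ← Real.sqrt_mul zero_le_two, Real.norm_eq_abs]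
      have hb : |1 - x⁻¹ * y k| ≤ 1 + |y k| := by
        calc |1 - x⁻¹ * y k| ≤ |1| + |x⁻¹ * y k| := abs_sub _ _
          _ ≤ 1 + |y k| := by
            rw [abs_one, abs_mul]
            nlinarith [abs_nonneg (y k)]
      refine hb.trans (Real.le_sqrt_of_sq_le ?_)
      nlinarith [sq_nonneg (1 - |y k|), sq_abs (y k)]
    · refine ae_of_all _ fun y => ?_
      have : Tendsto (fun x : ℝ => ∏ k, (1 - x⁻¹ * y k) ^ m) l
          (𝓝 (∏ k : Fin (size n), (1 - 0 * y k) ^ m)) :=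
        tendsto_finsetProd _ fun k _ => (tendsto_const_nhds.sub (hl.mul_const _)).pow _
      simpa using this
  refine hlim.congr' ?_
  filter_upwards [hl0] with x hx
  rw [moment, ← integral_div]
  refine integral_congr_ae (ae_of_all _ fun y => ?_)
  simp only [charPow, RCLike.ofReal_real_eq_id, id]
  rw [mul_comm, pow_mul]
  have hcard : (x ^ m) ^ size n = ∏ _k : Fin (size n), x ^ m := by simp
  rw [hcard, ← Finset.prod_div_distrib]
  refine Finset.prod_congr rfl fun k _ => ?_
  rw [← div_pow, sub_div, div_self hx, div_eq_inv_mul]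

theorem IsATWeights.eventually_moment_mul_pow_pos (h : IsATWeights I w) (n : Fin r → ℕ) (m : ℕ)
    {l : Filter ℝ} [l.IsCountablyGenerated] (hl : Tendsto (fun x : ℝ => x⁻¹) l (𝓝 0))
    (hl0 : ∀ᶠ x in l, x ≠ 0) :
    ∀ᶠ x in l, 0 < moment I w n m x * x ^ (size n * m) := by
  filter_upwards [(h.tendsto_moment_div_pow n m hl hl0).eventually (eventually_gt_nhds one_pos),
    hl0] with x hx hx0
  have := mul_pos hx (sq_pos_of_ne_zero (pow_ne_zero (size n * m) hx0))
  rwa [div_mul_eq_mul_div, sq, ← mul_assoc, mul_div_cancel_right₀ _ (pow_ne_zero _ hx0)] at this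

end Asymptotics

end MOP

namespace MOP

variable {r : ℕ} {I : Set ℝ} {w : Fin r → ℝ → ℝ}

/-! ### Zeros of odd moments -/

section Zeros

open Filter Topology

theorem size_add_single (n : Fin r → ℕ) (k : Fin r) (i : ℕ) :
    size (n + Pi.single k i) = size n + i := by
  simp [size, Finset.sum_add_distrib]

theorem isPath_add_single (n : Fin r → ℕ) (k : Fin r) (m : ℕ) :
    IsPath n fun i : Fin m => n + Pi.single k (i : ℕ) where
  start _ := by simp
  size_eq i := size_add_single n k i
  mono _ _ hij := add_le_add_right (Pi.single_mono k hij) n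

/-- The moments of `n + s e_k` as Wronskians along the path in the direction `e_k`. -/
theorem IsATWeights.moment_add_single (h : IsATWeights I w) (n : Fin r → ℕ) (k : Fin r)
    (s m : ℕ) (x : ℝ) :
    moment I w (n + Pi.single k s) m x = (∏ i ∈ Finset.range m, (i.factorial : ℝ))⁻¹ *
      (wronskian fun i : Fin m => typeII I w (n + Pi.single k ((i : ℕ) + s))).eval x := by
  have hpath := isPath_add_single (n + Pi.single k s) k m
  rw [h.moment_eq_wronskian _ m _ hpath, coe_aeval_eq_eval]
  simp only [add_assoc, ← Pi.single_add, add_comm s]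

theorem IsATWeights.hasDerivAt_moment (h : IsATWeights I w) (n : Fin r → ℕ) (m : ℕ) (x : ℝ) :
    HasDerivAt (fun y : ℝ => moment I w n m y) (deriv (fun y : ℝ => moment I w n m y) x) x := by
  have hpath := isPath_add_single n ⟨0, h.pos⟩ m
  simp only [h.moment_eq_wronskian n m _ hpath, coe_aeval_eq_eval]
  exact ((Polynomial.differentiable _).const_mul _ x).hasDerivAt

/-- With `m = l + 1` and `l` even, Sylvester's identity factors the expression into Wronskians of
sizes `l` and `l + 2`, which are positive multiples of even moments. -/
theorem IsATWeights.moment_wronskian_pos (h : IsATWeights I w) (n : Fin r → ℕ) (k : Fin r)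
    {m : ℕ} (hm : Odd m) (x : ℝ) :
    0 < moment I w n m x * deriv (fun y : ℝ => moment I w (n + Pi.single k 1) m y) x -
      deriv (fun y : ℝ => moment I w n m y) x * moment I w (n + Pi.single k 1) m x := by
  obtain ⟨l, rfl⟩ : ∃ l, m = l + 1 := ⟨m - 1, by have := hm.pos; omega⟩
  have hl : Even l := by simpa [Nat.odd_add_one] using hm
  set F : ℕ → ℝ[X] := fun i => typeII I w (n + Pi.single k i) with hF
  have hc : ∀ m : ℕ, 0 < (∏ i ∈ Finset.range m, (i.factorial : ℝ))⁻¹ := fun m =>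
    inv_pos.2 (Finset.prod_pos fun i _ => Nat.cast_pos.2 i.factorial_pos)
  have h0 : ∀ m (y : ℝ), moment I w n m y = (∏ i ∈ Finset.range m, (i.factorial : ℝ))⁻¹ *
      (wronskian fun i : Fin m => F i).eval y := fun m y => by
    simpa using h.moment_add_single n k 0 m y
  have h1 : ∀ m (y : ℝ), moment I w (n + Pi.single k 1) m y =
      (∏ i ∈ Finset.range m, (i.factorial : ℝ))⁻¹ *
        (wronskian fun i : Fin m => F (i + 1)).eval y := h.moment_add_single n k 1
  have hp1 : 0 < (wronskian fun i : Fin l => F (i + 1)).eval x := by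
    have := h.moment_pos_of_even (n + Pi.single k 1) hl x
    rw [h1] at this
    exact (mul_pos_iff_of_pos_left (hc _)).1 this
  have hp2 : 0 < (wronskian fun i : Fin (l + 2) => F i).eval x := by
    have := h.moment_pos_of_even n (hl.add (by decide : Even 2)) x
    rw [h0] at this
    exact (mul_pos_iff_of_pos_left (hc _)).1 this
  have key := wronskian_mul_derivative_sub hl F x hp1.ne'
  have hpos := mul_pos hp1 hp2
  rw [← key] at hpos
  simp only [h0, h1, deriv_const_mul_field, Polynomial.deriv]
  have := mul_pos (mul_pos (hc (l + 1)) (hc (l + 1))) hpos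
  linarith

theorem IsATWeights.exists_interlacing_momentZeros (h : IsATWeights I w) (n : Fin r → ℕ)
    (k : Fin r) {m N : ℕ} (hm : Odd m) {a : Fin N → ℝ} (ha : StrictMono a)
    (hrange : Set.range a = momentZeros I w n m) :
    ∃ b : Fin (N + 1) → ℝ, StrictMono b ∧
      Set.range b = momentZeros I w (n + Pi.single k 1) m ∧
      ∀ i : Fin N, b i.castSucc < a i ∧ a i < b i.succ := by
  -- The exponent is `(2|n| + 1) m`, so the product of the two moments has opposite signs at the two
  -- infinities.
  have hodd : Odd (size n * m + size (n + Pi.single k 1) * m) := by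
    rw [size_add_single, ← add_mul, ← add_assoc]
    exact (Even.add_one ⟨_, rfl⟩).mul hm
  have hasymp : ∀ {l : Filter ℝ} [l.IsCountablyGenerated],
      Tendsto (fun x : ℝ => x⁻¹) l (𝓝 0) → (∀ᶠ x in l, x ≠ 0) →
      ∀ᶠ x in l, 0 < (moment I w n m x * moment I w (n + Pi.single k 1) m x) *
        x ^ (size n * m + size (n + Pi.single k 1) * m) := by
    intro l _ hl hl0
    filter_upwards [h.eventually_moment_mul_pow_pos n m hl hl0,
      h.eventually_moment_mul_pow_pos (n + Pi.single k 1) m hl hl0] with x hx hx'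
    rw [pow_add, mul_mul_mul_comm]
    exact mul_pos hx hx'
  refine exists_interlacing_zeros (h.hasDerivAt_moment n m)
    (h.hasDerivAt_moment (n + Pi.single k 1) m) (h.moment_wronskian_pos n k hm) ?_ ?_ ha hrange
  · filter_upwards [hasymp tendsto_inv_atTop_zero (eventually_ne_atTop 0),
      eventually_gt_atTop 0] with x hx hx0
    exact pos_of_mul_pos_left hx (pow_pos hx0 _).le
  · filter_upwards [hasymp tendsto_inv_atBot_zero (eventually_ne_atBot 0),
      eventually_lt_atBot 0] with x hx hx0
    exact neg_of_mul_pos_left hx (hodd.pow_neg hx0).le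

/-- Induction by lowering one positive component of `n`: interlacing adds exactly one zero, starting
from the constant moment `1` at size `0`. -/
theorem IsATWeights.exists_momentZeros (h : IsATWeights I w) {m : ℕ} (hm : Odd m) (N : ℕ)
    (n : Fin r → ℕ) (hn : size n = N) :
    ∃ a : Fin N → ℝ, StrictMono a ∧ Set.range a = momentZeros I w n m := by
  induction N generalizing n with
  | zero =>
    refine ⟨fun i => i.elim0, fun i => i.elim0, ?_⟩
    rw [Set.range_eq_empty, eq_comm, Set.eq_empty_iff_forall_notMem]
    intro x hx
    have : IsEmpty (Fin (size n)) := by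
      rw [hn]
      infer_instance
    have := h.isProbabilityMeasure_ensemble n
    have h1 : moment I w n m x = 1 := by
      simp [moment, charPow]
    exact one_ne_zero (h1.symm.trans hx)
  | succ N ih =>
    obtain ⟨k, hk⟩ : ∃ k, n k ≠ 0 := by
      by_contra! hall
      simp [size, hall] at hn
    have hsub : n - Pi.single k 1 + Pi.single k 1 = n := by
      refine tsub_add_cancel_of_le fun j => ?_
      by_cases hj : j = k
      · subst hj
        simpa using Nat.one_le_iff_ne_zero.2 hk
      · simp [Pi.single_eq_of_ne hj]
    have hsize : size (n - Pi.single k 1) = N := by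
      have := size_add_single (n - Pi.single k 1) k 1
      rw [hsub, hn] at this
      omega
    obtain ⟨a, ha, hrange⟩ := ih _ hsize
    obtain ⟨b, hb, hb', -⟩ := h.exists_interlacing_momentZeros _ k hm ha hrange
    rw [hsub] at hb'
    exact ⟨b, hb, hb'⟩

end Zeros

end MOP

theorem corollary3p1 (r : ℕ) (hr : 0 < r) (I : Set ℝ) (hI : I.OrdConnected)
    (w : Fin r → ℝ → ℝ)
    (hcont : ∀ j, ContinuousOn (w j) I)
    (hmom : ∀ (j : Fin r) (k : ℕ), IntegrableOn (fun x => x ^ k * w j x) I)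
    (hAT : ∀ n : Fin r → ℕ, MOP.IsATSystem I w n) :
    -- the type II polynomials exist and are unique
    (∀ n : Fin r → ℕ, MOP.IsTypeII I w n (MOP.typeII I w n) ∧
      ∀ Q : ℝ[X], MOP.IsTypeII I w n Q → Q = MOP.typeII I w n) ∧
    -- the ensemble is well defined, and the moments are finite
    (∀ n : Fin r → ℕ,
      (∀ x ∈ MOP.cube I (MOP.size n), 0 ≤ MOP.jointDensity I w n x) ∧
      IsProbabilityMeasure (MOP.ensemble I w n) ∧
      ∀ (m : ℕ) (z : ℂ), Integrable (MOP.charPow (MOP.size n) m z) (MOP.ensemble I w n)) ∧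
    -- the moments are Wronskians along an arbitrary path
    (∀ (n : Fin r → ℕ) (m : ℕ) (p : Fin m → Fin r → ℕ), MOP.IsPath n p → ∀ z : ℂ,
      MOP.moment I w n m z =
        (∏ i ∈ Finset.range m, (i.factorial : ℂ))⁻¹ *
          aeval z (MOP.wronskian fun i => MOP.typeII I w (p i))) ∧
    -- even moments are positive on the real line
    (∀ (n : Fin r → ℕ) (m : ℕ), Even m → ∀ x : ℝ, 0 < MOP.moment I w n m x) ∧
    -- odd moments have exactly `|n|` real zeros, all simple, and consecutive ones interlace
    (∀ (n : Fin r → ℕ) (m : ℕ), Odd m →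
      (MOP.momentZeros I w n m).encard = (MOP.size n : ℕ∞) ∧
      (∀ x ∈ MOP.momentZeros I w n m, deriv (fun y : ℝ => MOP.moment I w n m y) x ≠ 0) ∧
      ∀ k : Fin r, MOP.StrictlyInterlace (MOP.size n)
        (MOP.momentZeros I w n m) (MOP.momentZeros I w (n + Pi.single k 1) m)) := by
  have h : MOP.IsATWeights I w := ⟨hr, hI, hcont, hmom, hAT⟩
  refine ⟨fun n => ⟨h.isTypeII_typeII n, fun Q hQ => h.isTypeII_unique n hQ (h.isTypeII_typeII n)⟩,
    fun n => ⟨fun x hx => h.jointDensity_nonneg n hx, h.isProbabilityMeasure_ensemble n,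
      fun m z => h.integrable_charPow n m z⟩,
    fun n m p hp z => h.moment_eq_wronskian n m p hp z,
    fun n m hm x => h.moment_pos_of_even n hm x, fun n m hm => ?_⟩
  obtain ⟨a, ha, hrange⟩ := h.exists_momentZeros hm _ n rfl
  refine ⟨?_, fun x hx h0 => ?_, fun k => ?_⟩
  · rw [← hrange, ← Set.image_univ, ha.injective.encard_image, Set.encard_univ,
      ENat.card_eq_coe_fintype_card, Fintype.card_fin]
  -- At a multiple zero both terms of the positive Wronskian expression would vanish; any direction
  -- serves here.
  · have := h.moment_wronskian_pos n ⟨0, hr⟩ hm x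
    rw [h0, show MOP.moment I w n m x = 0 from hx] at this
    simp at this
  · obtain ⟨b, -, hb', hab⟩ := h.exists_interlacing_momentZeros n k hm ha hrange
    exact ⟨a, b, hrange, hb', hab⟩
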